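/- A metric space is proper if its closed balls are compact. A CAT(0) space $X$ is almost extendible if there is a constant $M>0$ such that for all $x,y\in X$ there is a geodesic ray $\zeta:[0,\infty)\to X$ with $\zeta(0)=x$ that passes within $M$ of $y$. For an isometry $\gamma$ of $X$ let $|\gamma|=\inf_{x\in X}d(x,\gamma x)$ and $\operatorname{Min}(\gamma)=\{x\in X : d(x,\gamma x)=|\gamma|\}$; $\gamma$ is hyperbolic if $\operatorname{Min}(\gamma)\neq\emptyset$ and $|\gamma|>0$, and then $\gamma^\infty$ denotes the point of the visual boundary $\partial X$ to which the sequence $(\gamma^i x_0)_{i\ge 0}$ converges in the cone topology on $X\cup\partial X$, for $x_0\in X$. A reflection of $X$ is an isometry $r$ of $X$ with fixed-point set $F_r$ such that $r^2=\mathrm{id}$, the set $X\setminus F_r$ has exactly two connected components $X_r^+$ and $X_r^-$, both are convex, and $rX_r^+=X_r^-$. By $\partial F_r\subset\partial X$ we mean the set of end points of the geodesic rays contained in $F_r$. Theorem. Let $X$ be a proper and almost extendible CAT(0) space, let $\gamma$ be a hyperbolic isometry of $X$, and let $r$ be a reflection of $X$. If (1) $\gamma^\infty\notin\partial F_r$,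 (2) $\gamma(\partial F_r)\subset\partial F_r$, and (3) $\operatorname{Min}(\gamma)\cap F_r=\emptyset$, then the visual boundary $\partial X$, with the cone topology, is not locally connected. -/

import Mathlib

open Set Filter Topology
open scoped NNReal

universe u

namespace CATZero

variable {X : Type u} [MetricSpace X]

/-- The restriction of `c` to `[0, dist x y]` is a geodesic (parametrised by arc length)
from `x` to `y`. -/
structure IsGeodesic (c : ℝ → X) (x y : X) : Prop where
  start : c 0 = x
  finish : c (dist x y) = y
  dist_eq : ∀ s ∈ Icc (0 : ℝ) (dist x y), ∀ t ∈ Icc (0 : ℝ) (dist x y),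
    dist (c s) (c t) = |s - t|

/-- A CAT(0) space: a geodesic metric space in which every geodesic triangle is at least as thin
as its comparison triangles in the Euclidean plane. Any two sides of a triangle share a vertex,
here called `x`; the points at proportions `s` and `t` of the two sides are compared. -/
structure IsCAT0 (X : Type u) [MetricSpace X] : Prop where
  exists_geodesic : ∀ x y : X, ∃ c : ℝ → X, IsGeodesic c x y
  comparison : ∀ (x y z : X) (c₁ c₂ : ℝ → X), IsGeodesic c₁ x y → IsGeodesic c₂ x z →
    ∀ x' y' z' : EuclideanSpace ℝ (Fin 2),
      dist x' y' = dist x y → dist x' z' = dist x z → dist y' z' = dist y z →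
    ∀ s ∈ Icc (0 : ℝ) 1, ∀ t ∈ Icc (0 : ℝ) 1,
      dist (c₁ (s * dist x y)) (c₂ (t * dist x z)) ≤
        dist (AffineMap.lineMap x' y' s : EuclideanSpace ℝ (Fin 2)) (AffineMap.lineMap x' z' t)

/-- `C` contains every geodesic joining two of its points. -/
def IsGeodesicallyConvex (C : Set X) : Prop :=
  ∀ x ∈ C, ∀ y ∈ C, ∀ c : ℝ → X, IsGeodesic c x y → ∀ t ∈ Icc (0 : ℝ) (dist x y), c t ∈ C

/-- A geodesic ray `[0, ∞) → X`. -/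
structure GeodesicRay (X : Type u) [MetricSpace X] where
  toFun : ℝ≥0 → X
  isometry : Isometry toFun

instance : CoeFun (GeodesicRay X) (fun _ => ℝ≥0 → X) := ⟨GeodesicRay.toFun⟩

/-- The space is almost extendible. -/
def IsAlmostExtendible (X : Type u) [MetricSpace X] : Prop :=
  ∃ M : ℝ, 0 < M ∧ ∀ x y : X, ∃ ζ : GeodesicRay X, ζ 0 = x ∧ ∃ t : ℝ≥0, dist (ζ t) y ≤ M

/-- Two rays are asymptotic if they stay at bounded distance from each other. -/
def Asymptotic (c c' : GeodesicRay X) : Prop :=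
  ∃ K : ℝ, ∀ t : ℝ≥0, dist (c t) (c' t) ≤ K

instance asymptoticSetoid (X : Type u) [MetricSpace X] : Setoid (GeodesicRay X) where
  r := Asymptotic
  iseqv :=
    { refl := fun c => ⟨0, fun t => (dist_self (c t)).le⟩
      symm := fun ⟨K, h⟩ => ⟨K, fun t => (dist_comm _ _).trans_le (h t)⟩
      trans := fun ⟨K, h⟩ ⟨L, h'⟩ =>
        ⟨K + L, fun t => (dist_triangle _ _ _).trans (add_le_add (h t) (h' t))⟩ }

/-- The visual boundary `∂X`: asymptotic classes of geodesic rays. -/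
def Boundary (X : Type u) [MetricSpace X] : Type u := Quotient (asymptoticSetoid X)

/-- The end point `c(∞)` of a ray. -/
def GeodesicRay.endpoint (c : GeodesicRay X) : Boundary X := Quotient.mk (asymptoticSetoid X) c

/-- The boundary of a (closed convex) subset `A`, as a subset of `∂X`: the end points of the
geodesic rays contained in `A`. -/
def boundaryOf (A : Set X) : Set (Boundary X) :=
  {η | ∃ c : GeodesicRay X, (∀ t, c t ∈ A) ∧ c.endpoint = η}

/-- The image of a ray under an isometry. -/
def GeodesicRay.map (g : X ≃ᵢ X) (c : GeodesicRay X) : GeodesicRay X :=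
  ⟨fun t => g (c t), g.isometry.comp c.isometry⟩

/-- The action of an isometry on the boundary, `c(∞) ↦ (g ∘ c)(∞)`. -/
def boundaryMap (g : X ≃ᵢ X) : Boundary X → Boundary X :=
  Quotient.map (GeodesicRay.map g)
    (fun _ _ ⟨K, h⟩ => ⟨K, fun t => (g.isometry.dist_eq _ _).trans_le (h t)⟩)

/-- The set `U_{x₀}(α; R, ε)` in `X ∪ ∂X`, for a ray `α` issuing from `x₀`: the points of `X`
outside the ball of radius `R` about `x₀`, and the points of `∂X`, such that the geodesic (resp.
the ray) from `x₀` to that point is at time `R` at distance less than `ε` from `α R`. -/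
def coneNhd (x₀ : X) (α : GeodesicRay X) (R : ℝ≥0) (ε : ℝ) : Set (X ⊕ Boundary X) :=
  Sum.inl '' {x | (R : ℝ) < dist x₀ x ∧
      ∃ c : ℝ → X, IsGeodesic c x₀ x ∧ dist (α R) (c R) < ε} ∪
  Sum.inr '' {η | ∃ β : GeodesicRay X, β 0 = x₀ ∧ β.endpoint = η ∧ dist (α R) (β R) < ε}

/-- The cone topology on `X ∪ ∂X` with base point `x₀`, generated by the open sets of `X` and the
sets `U_{x₀}(α; R, ε)`. -/
@[reducible] def coneTopology (x₀ : X) : TopologicalSpace (X ⊕ Boundary X) :=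
  TopologicalSpace.generateFrom
    ({W | ∃ V : Set X, IsOpen V ∧ W = Sum.inl '' V} ∪
     {W | ∃ (α : GeodesicRay X) (R : ℝ≥0) (ε : ℝ),
        α 0 = x₀ ∧ 0 < R ∧ 0 < ε ∧ W = coneNhd x₀ α R ε})

/-- The cone topology on `∂X` (with base point `x₀`): the subspace topology. -/
@[reducible] def boundaryTopology (x₀ : X) : TopologicalSpace (Boundary X) :=
  TopologicalSpace.induced Sum.inr (coneTopology x₀)

/-- The translation length `|g|`. -/
noncomputable def translationLength (g : X ≃ᵢ X) : ℝ := ⨅ x : X, dist x (g x)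

/-- The minimal set `Min(g)`. -/
def minSet (g : X ≃ᵢ X) : Set X := {x | dist x (g x) = translationLength g}

/-- Hyperbolic isometries. -/
def IsHyperbolic (g : X ≃ᵢ X) : Prop := (minSet g).Nonempty ∧ 0 < translationLength g

/-- `η` is the point `g^∞` of `∂X`: the sequence `g ^ i x₀` converges to `η` in `X ∪ ∂X`
for every `x₀`. -/
def IsLimitAtInfinity (g : X ≃ᵢ X) (η : Boundary X) : Prop :=
  ∀ x₀ : X, Tendsto (fun i : ℕ => (Sum.inl ((g ^ i) x₀) : X ⊕ Boundary X)) atTop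
    (@nhds _ (coneTopology x₀) (Sum.inr η))

/-- The fixed-point set `F_r`. -/
def fixedSet (r : X ≃ᵢ X) : Set X := {x | r x = x}

/-- The set of connected components of a subset `S`. -/
def componentsOf (S : Set X) : Set (Set X) := {C | ∃ x ∈ S, C = connectedComponentIn S x}

/-- Reflections: involutive isometries such that the complement of the fixed-point set has exactly
two connected components, which are convex and are exchanged by `r`. -/
def IsReflection (r : X ≃ᵢ X) : Prop :=
  (∀ x, r (r x) = x) ∧
  ∃ P N : Set X, P ≠ N ∧ componentsOf (fixedSet r)ᶜ = {P, N} ∧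
    IsGeodesicallyConvex P ∧ IsGeodesicallyConvex N ∧ r '' P = N

end CATZero

open CATZero

namespace CATZero

variable {X : Type u} [MetricSpace X]

/-! ### Comparison inequalities -/

/-! Write F for the fixed set of r, P and N for the sides of F, and take p in Min(γ) ∩ P. Min(γ)
misses F and contains the geodesics from q to γq, so the whole orbit of p stays in P. Hence the
forward orbit, carried by a ray b ending at γ^∞, lies in every γ^i P.

Since γ^∞ ∉ ∂F, the points γ^n p get arbitrarily far from F, and y = r γ^n p is as deep in N as
desired. Almost extendibility gives rays ζ_i from x₀ passing within M of γ^i y, deep in γ^i N; they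
end on the N-side of γ^i F (`IsWall.endpoint_mem_farSide_of_deep`). As d(γ^i y, γ^i p) does not
depend on i, the end points of the ζ_i converge to γ^∞.

Each wall γ^i F splits ∂X \ ∂(γ^i F) into two disjoint open sets, one containing γ^∞ and the other
ζ_i(∞). Since ∂(γ^i F) ⊂ ∂F (`boundaryOf_image_pow_subset`), no connected subset of the open set ∂X
\ ∂F contains both points. So local connectedness fails at γ^∞.

The engine is the convexity of the distance to F along a ray (`IsCAT0.infDist_ray_convex`): once it
has increased it grows at least linearly, so a finite time decides on which side of F the ray ends.
-/

theorem exists_comparison_triangle {a b c : ℝ} (ha : 0 ≤ a) (hb : 0 ≤ b)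
    (h₁ : a ≤ b + c) (h₂ : b ≤ a + c) (h₃ : c ≤ a + b) :
    ∃ x y z : EuclideanSpace ℝ (Fin 2), dist x y = a ∧ dist x z = b ∧ dist y z = c := by
  rcases ha.eq_or_lt with rfl | ha
  · have hbc : b = c := by linarith
    subst hbc
    refine ⟨!₂[0, 0], !₂[0, 0], !₂[b, 0], ?_, ?_, ?_⟩ <;>
      simp [EuclideanSpace.dist_eq, Fin.sum_univ_two, Real.dist_eq, Real.sqrt_sq_eq_abs,
        abs_of_nonneg hb]
  -- With x at the origin and y on the first axis, w is the first coordinate of z given by the law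
  -- of cosines; the triangle inequalities yield |w| ≤ b.
  · obtain ⟨w, hw⟩ : ∃ w, w = (a ^ 2 + b ^ 2 - c ^ 2) / (2 * a) := ⟨_, rfl⟩
    have hw' : 2 * a * w = a ^ 2 + b ^ 2 - c ^ 2 := by rw [hw]; field_simp
    have hc : 0 ≤ c := by linarith
    have hwb : w ^ 2 ≤ b ^ 2 := by
      refine sq_le_sq' ?_ ?_ <;> nlinarith
    have hv : 0 ≤ b ^ 2 - w ^ 2 := by linarith
    refine ⟨!₂[0, 0], !₂[a, 0], !₂[w, √(b ^ 2 - w ^ 2)], ?_, ?_, ?_⟩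
    · simp [EuclideanSpace.dist_eq, Fin.sum_univ_two, Real.dist_eq, Real.sqrt_sq_eq_abs,
        abs_of_pos ha]
    · simp [EuclideanSpace.dist_eq, Fin.sum_univ_two, Real.dist_eq, Real.sq_sqrt hv,
        Real.sqrt_sq_eq_abs, abs_of_nonneg hb]
    · simp only [EuclideanSpace.dist_eq, Fin.sum_univ_two, Real.dist_eq, sq_abs]
      simp only [Matrix.cons_val_zero, Matrix.cons_val_one, zero_sub, neg_sq,
        Real.sq_sqrt hv]
      rw [show (a - w) ^ 2 + (b ^ 2 - w ^ 2) = c ^ 2 by linarith [hw'], Real.sqrt_sq hc]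

/-- Only the three side lengths occur on the right, so the comparison triangle can be eliminated
from the CAT(0) inequality. -/
theorem dist_lineMap_lineMap_sq {E : Type*} [NormedAddCommGroup E] [InnerProductSpace ℝ E]
    (x y z : E) (s t : ℝ) :
    dist (AffineMap.lineMap x y s : E) (AffineMap.lineMap x z t) ^ 2 =
      s ^ 2 * dist x y ^ 2 + t ^ 2 * dist x z ^ 2
        - s * t * (dist x y ^ 2 + dist x z ^ 2 - dist y z ^ 2) := by
  have h : (AffineMap.lineMap x y s : E) - AffineMap.lineMap x z t
      = s • (y - x) - t • (z - x) := by
    simp [AffineMap.lineMap_apply]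
  have h' : y - z = (y - x) - (z - x) := by abel
  rw [dist_eq_norm, h, dist_comm x y, dist_comm x z, dist_eq_norm, dist_eq_norm, dist_eq_norm y z,
    h', norm_sub_sq_real (s • (y - x)), norm_sub_sq_real (y - x), norm_smul, norm_smul, inner_smul_left,
    inner_smul_right, mul_pow, mul_pow]
  simp only [Real.norm_eq_abs, sq_abs, conj_trivial]
  ring

theorem IsCAT0.dist_sq_le (hX : IsCAT0 X) {x y z : X} {c₁ c₂ : ℝ → X}
    (h₁ : IsGeodesic c₁ x y) (h₂ : IsGeodesic c₂ x z) {s t : ℝ}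
    (hs : s ∈ Icc (0 : ℝ) 1) (ht : t ∈ Icc (0 : ℝ) 1) :
    dist (c₁ (s * dist x y)) (c₂ (t * dist x z)) ^ 2 ≤
      s ^ 2 * dist x y ^ 2 + t ^ 2 * dist x z ^ 2
        - s * t * (dist x y ^ 2 + dist x z ^ 2 - dist y z ^ 2) := by
  obtain ⟨x', y', z', hxy, hxz, hyz⟩ := exists_comparison_triangle (a := dist x y)
    (b := dist x z) (c := dist y z) dist_nonneg dist_nonneg
    (dist_comm y z ▸ dist_triangle x z y) (dist_triangle x y z)
    (dist_comm x y ▸ dist_triangle y x z)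
  have h := hX.comparison x y z c₁ c₂ h₁ h₂ x' y' z' hxy hxz hyz s hs t ht
  rw [← hxy, ← hxz, ← hyz, ← dist_lineMap_lineMap_sq, hxy, hxz]
  exact pow_le_pow_left₀ dist_nonneg h 2

theorem IsCAT0.dist_le_mul (hX : IsCAT0 X) {x y z : X} {c₁ c₂ : ℝ → X}
    (h₁ : IsGeodesic c₁ x y) (h₂ : IsGeodesic c₂ x z) {s : ℝ} (hs : s ∈ Icc (0 : ℝ) 1) :
    dist (c₁ (s * dist x y)) (c₂ (s * dist x z)) ≤ s * dist y z := by
  refine le_of_sq_le_sq ?_ (mul_nonneg hs.1 dist_nonneg)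
  exact (hX.dist_sq_le h₁ h₂ hs hs).trans_eq (by ring)

theorem IsGeodesic.symm {c : ℝ → X} {x y : X} (h : IsGeodesic c x y) :
    IsGeodesic (fun t => c (dist x y - t)) y x where
  start := by simpa using h.finish
  finish := by simpa [dist_comm y x] using h.start
  dist_eq s hs t ht := by
    rw [dist_comm y x] at hs ht
    rw [h.dist_eq _ ⟨by linarith [hs.2], by linarith [hs.1]⟩ _
      ⟨by linarith [ht.2], by linarith [ht.1]⟩, abs_sub_comm]
    congr 1
    ring

theorem IsGeodesic.comp_isometry {Y : Type*} [MetricSpace Y] {c : ℝ → X} {x y : X}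
    (h : IsGeodesic c x y) {g : X → Y} (hg : Isometry g) :
    IsGeodesic (fun t => g (c t)) (g x) (g y) where
  start := by rw [h.start]
  finish := by rw [hg.dist_eq, h.finish]
  dist_eq s hs t ht := by
    rw [hg.dist_eq] at hs ht
    rw [hg.dist_eq, h.dist_eq s hs t ht]

theorem IsGeodesic.dist_left {c : ℝ → X} {x y : X} (h : IsGeodesic c x y) {t : ℝ}
    (ht : t ∈ Icc (0 : ℝ) (dist x y)) : dist x (c t) = t := by
  have := h.dist_eq 0 ⟨le_rfl, dist_nonneg⟩ t ht
  rwa [h.start, zero_sub, abs_neg, abs_of_nonneg ht.1] at this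

theorem IsGeodesic.dist_right {c : ℝ → X} {x y : X} (h : IsGeodesic c x y) {t : ℝ}
    (ht : t ∈ Icc (0 : ℝ) (dist x y)) : dist (c t) y = dist x y - t := by
  have := h.dist_eq t ht (dist x y) ⟨dist_nonneg, le_rfl⟩
  rwa [h.finish, abs_sub_comm, abs_of_nonneg (by linarith [ht.2])] at this

/-- The distance between two affinely parametrised geodesics is convex. -/
theorem IsCAT0.dist_le_convex_comb (hX : IsCAT0 X) {x y x' y' : X} {g h : ℝ → X}
    (hg : IsGeodesic g x y) (hh : IsGeodesic h x' y') {s : ℝ} (hs : s ∈ Icc (0 : ℝ) 1) :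
    dist (g (s * dist x y)) (h (s * dist x' y')) ≤ (1 - s) * dist x x' + s * dist y y' := by
  -- The diagonal k cuts the quadrilateral into two triangles, with apexes x and y'; each
  -- contributes one term.
  obtain ⟨k, hk⟩ := hX.exists_geodesic x y'
  have h₁ := hX.dist_le_mul hg hk hs
  have h₂ := hX.dist_le_mul hk.symm hh.symm (s := 1 - s) ⟨by linarith [hs.2], by linarith [hs.1]⟩
  have e : ∀ a b : X, dist a b - (1 - s) * dist b a = s * dist a b := fun a b => by
    rw [dist_comm b a]; ring
  rw [e, e] at h₂
  linarith [dist_triangle (g (s * dist x y)) (k (s * dist x y')) (h (s * dist x' y'))]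

/-- A point through which the triangle inequality is an equality lies on the geodesic. -/
theorem IsCAT0.geodesic_apply_dist (hX : IsCAT0 X) {x y z : X} {c : ℝ → X}
    (hc : IsGeodesic c x z) (h : dist x y + dist y z = dist x z) : c (dist x y) = y := by
  rcases (dist_nonneg : 0 ≤ dist x z).eq_or_lt with h0 | h0
  · have hxy : dist x y = 0 := by linarith [@dist_nonneg _ _ x y, @dist_nonneg _ _ y z]
    rw [hxy, hc.start, dist_eq_zero.1 hxy]
  · obtain ⟨k, hk⟩ := hX.exists_geodesic x y
    have hle : dist x y ≤ dist x z := by linarith [@dist_nonneg _ _ y z]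
    have := hX.dist_sq_le hk hc (s := 1) (t := dist x y / dist x z) ⟨zero_le_one, le_rfl⟩
      ⟨by positivity, (div_le_one h0).2 hle⟩
    rw [one_mul, hk.finish, div_mul_cancel₀ _ h0.ne'] at this
    have hyz : dist y z = dist x z - dist x y := by linarith
    -- The comparison triangle is degenerate, so the comparison bound is zero.
    have e : (1 : ℝ) ^ 2 * dist x y ^ 2 + (dist x y / dist x z) ^ 2 * dist x z ^ 2
        - 1 * (dist x y / dist x z) * (dist x y ^ 2 + dist x z ^ 2 - dist y z ^ 2) = 0 := by
      rw [hyz]; field_simp; ring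
    rw [e] at this
    exact (dist_eq_zero.1 (pow_eq_zero_iff two_ne_zero |>.1
      (le_antisymm this (sq_nonneg _)))).symm

theorem IsCAT0.geodesic_unique (hX : IsCAT0 X) {x y : X} {c c' : ℝ → X}
    (hc : IsGeodesic c x y) (hc' : IsGeodesic c' x y) {t : ℝ}
    (ht : t ∈ Icc (0 : ℝ) (dist x y)) : c t = c' t := by
  have := hX.geodesic_apply_dist hc (y := c' t) (by
    rw [hc'.dist_left ht, hc'.dist_right ht]; ring)
  rwa [hc'.dist_left ht] at this

theorem IsGeodesic.isPreconnected_image {c : ℝ → X} {x y : X} (h : IsGeodesic c x y) :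
    IsPreconnected (c '' Icc 0 (dist x y)) := by
  have hi : Isometry (fun t : Icc (0 : ℝ) (dist x y) => c t) :=
    Isometry.of_dist_eq fun s t => h.dist_eq s s.2 t t.2
  refine isPreconnected_Icc.image c ?_
  rw [continuousOn_iff_continuous_domRestrict]
  exact hi.continuous

theorem IsGeodesic.left_mem_image {c : ℝ → X} {x y : X} (h : IsGeodesic c x y) :
    x ∈ c '' Icc 0 (dist x y) := ⟨0, ⟨le_rfl, dist_nonneg⟩, h.start⟩

theorem IsGeodesic.right_mem_image {c : ℝ → X} {x y : X} (h : IsGeodesic c x y) :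
    y ∈ c '' Icc 0 (dist x y) := ⟨_, ⟨dist_nonneg, le_rfl⟩, h.finish⟩

/-! ### Geodesic rays -/

theorem GeodesicRay.dist_apply (β : GeodesicRay X) (s t : ℝ≥0) :
    dist (β s) (β t) = |(s : ℝ) - t| := by
  rw [β.isometry.dist_eq, NNReal.dist_eq]

theorem GeodesicRay.dist_apply_of_le (β : GeodesicRay X) {s t : ℝ≥0} (h : s ≤ t) :
    dist (β s) (β t) = (t : ℝ) - s := by
  rw [β.dist_apply, abs_sub_comm, abs_of_nonneg (sub_nonneg.2 (NNReal.coe_le_coe.2 h))]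

theorem GeodesicRay.dist_zero_apply (β : GeodesicRay X) (t : ℝ≥0) : dist (β 0) (β t) = t := by
  simpa using β.dist_apply_of_le (zero_le : 0 ≤ t)

theorem GeodesicRay.isGeodesic (β : GeodesicRay X) {a b : ℝ≥0} (h : a ≤ b) :
    IsGeodesic (fun t : ℝ => β (a + t.toNNReal)) (β a) (β b) where
  start := by simp
  finish := by
    rw [β.dist_apply_of_le h, ← NNReal.coe_sub h, Real.toNNReal_coe, add_tsub_cancel_of_le h]
  dist_eq s hs t ht := by
    rw [β.dist_apply]
    simp [Real.coe_toNNReal _ hs.1, Real.coe_toNNReal _ ht.1]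

/-- A geodesic and a ray with close end points are close to each other. -/
theorem IsCAT0.dist_ray_le (hX : IsCAT0 X) {x y : X} {c : ℝ → X} (hc : IsGeodesic c x y)
    (β : GeodesicRay X) {R T : ℝ≥0} (hT : 0 < T) (hRT : R ≤ T) (hR : (R : ℝ) ≤ dist x y) :
    dist (c R) (β R) ≤ dist x (β 0) + 2 * (R / T) * dist y (β T) := by
  have hT' : (0 : ℝ) < T := hT
  have hs : (R / T : ℝ) ∈ Icc (0 : ℝ) 1 :=
    ⟨by positivity, (div_le_one hT').2 (NNReal.coe_le_coe.2 hRT)⟩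
  have h₁ := hX.dist_le_convex_comb hc (β.isGeodesic (zero_le : 0 ≤ T)) hs
  have e : (R / T : ℝ) * T = R := div_mul_cancel₀ _ hT'.ne'
  rw [β.dist_zero_apply, e, Real.toNNReal_coe, zero_add] at h₁
  -- Passing from time R to proportion R / T costs little: the length of c differs from T by at most
  -- the sum of the distances between end points.
  have h₂ : dist (c R) (c (R / T * dist x y))
      ≤ R / T * (dist x (β 0) + dist y (β T)) := by
    rw [hc.dist_eq _ ⟨R.coe_nonneg, hR⟩ _ ⟨mul_nonneg hs.1 dist_nonneg,
      mul_le_of_le_one_left dist_nonneg hs.2⟩]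
    have : (R : ℝ) - R / T * dist x y = R / T * (T - dist x y) := by
      rw [mul_sub, e]
    rw [this, abs_mul, abs_of_nonneg hs.1]
    refine mul_le_mul_of_nonneg_left (abs_le.2 ⟨?_, ?_⟩) hs.1
    · have := dist_triangle4 x (β 0) (β T) y
      rw [β.dist_zero_apply, dist_comm (β T) y] at this
      linarith
    · have := dist_triangle4 (β 0) x y (β T)
      rw [β.dist_zero_apply, dist_comm (β 0) x] at this
      linarith
  linarith [dist_triangle (c R) (c (R / T * dist x y)) (β R)]

theorem endpoint_eq_iff {c c' : GeodesicRay X} : c.endpoint = c'.endpoint ↔ Asymptotic c c' :=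
  Quotient.eq

/-- At a fixed time R, comparison of the rays up to time n bounds their distance by 2RK / n, which
tends to 0. -/
theorem IsCAT0.ray_eq_of_asymptotic (hX : IsCAT0 X) {β β' : GeodesicRay X} (h0 : β 0 = β' 0)
    (h : Asymptotic β β') : β = β' := by
  obtain ⟨K, hK⟩ := h
  have key : ∀ R : ℝ≥0, β R = β' R := by
    intro R
    have hlim : Tendsto (fun n : ℕ => 2 * ((R : ℝ) / n) * K) atTop (𝓝 0) := by
      simpa using ((tendsto_const_div_atTop_nhds_zero_nat (R : ℝ)).const_mul 2).mul_const K
    refine dist_le_zero.1 (ge_of_tendsto hlim ?_)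
    filter_upwards [eventually_gt_atTop ⌈R⌉₊] with n hn
    have hRn : R ≤ (n : ℝ≥0) := (Nat.le_ceil R).trans (Nat.cast_le.2 hn.le)
    have hn0 : (0 : ℝ≥0) < n := Nat.cast_pos.2 (by lia)
    have := hX.dist_ray_le (β.isGeodesic (zero_le : 0 ≤ (n : ℝ≥0))) β' hn0 hRn
      (by rw [β.dist_zero_apply]; exact_mod_cast hRn)
    rw [Real.toNNReal_coe, zero_add, h0, dist_self, zero_add, NNReal.coe_natCast] at this
    exact this.trans (mul_le_mul_of_nonneg_left (hK n) (by positivity))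
  cases β; cases β'
  congr
  exact funext key

theorem IsCAT0.ray_eq_of_endpoint_eq (hX : IsCAT0 X) {β β' : GeodesicRay X} (h0 : β 0 = β' 0)
    (h : β.endpoint = β'.endpoint) : β = β' :=
  hX.ray_eq_of_asymptotic h0 (endpoint_eq_iff.1 h)

/-- Geodesics issuing from a fixed point, of lengths tending to infinity, subconverge to a ray. -/
theorem exists_limit_ray [ProperSpace X] {x : X} {y : ℕ → X} {c : ℕ → ℝ → X}
    (hc : ∀ n, IsGeodesic (c n) x (y n)) (hy : Tendsto (fun n => dist x (y n)) atTop atTop) :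
    ∃ β : GeodesicRay X, β 0 = x ∧
      ∀ t : ℝ≥0, Tendsto (fun n => c n t) (hyperfilter ℕ) (𝓝 (β t)) := by
  have hev : ∀ t : ℝ≥0, ∀ᶠ n in (hyperfilter ℕ : Filter ℕ), (t : ℝ) ≤ dist x (y n) := fun t =>
    (hy.eventually_ge_atTop _).filter_mono Nat.hyperfilter_le_atTop
  -- Limits along one ultrafilter exist for all t simultaneously, which replaces a diagonal
  -- extraction of subsequences.
  have hex : ∀ t : ℝ≥0, ∃ a, Tendsto (fun n => c n t) (hyperfilter ℕ) (𝓝 a) := by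
    intro t
    obtain ⟨a, -, ha⟩ := (isCompact_closedBall x (t : ℝ)).ultrafilter_le_nhds
      ((hyperfilter ℕ).map fun n => c n t) (by
        rw [Ultrafilter.coe_map, le_principal_iff, mem_map]
        filter_upwards [hev t] with n hn
        rw [mem_preimage, Metric.mem_closedBall, dist_comm, (hc n).dist_left ⟨t.coe_nonneg, hn⟩])
    exact ⟨a, ha⟩
  choose β hβ using hex
  refine ⟨⟨β, Isometry.of_dist_eq fun s t => ?_⟩, ?_, hβ⟩
  · refine tendsto_nhds_unique ((hβ s).dist (hβ t)) (tendsto_const_nhds.congr' ?_)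
    filter_upwards [hev s, hev t] with n hs ht
    rw [(hc n).dist_eq _ ⟨s.coe_nonneg, hs⟩ _ ⟨t.coe_nonneg, ht⟩, NNReal.dist_eq]
  · refine tendsto_nhds_unique (hβ 0) (tendsto_const_nhds.congr fun n => ?_)
    rw [NNReal.coe_zero, (hc n).start]

/-- A ray which stays near a closed convex set is asymptotic to a ray in that set. -/
theorem IsCAT0.exists_asymptotic_ray_mem [ProperSpace X] (hX : IsCAT0 X) {C : Set X}
    (hC : IsClosed C) (hconv : IsGeodesicallyConvex C) (β : GeodesicRay X) {K : ℝ}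
    {f : ℕ → X} (hf : ∀ n, f n ∈ C) (hK : ∀ n : ℕ, dist (f n) (β n) ≤ K) {x : X} (hx : x ∈ C) :
    ∃ c : GeodesicRay X, c 0 = x ∧ (∀ t, c t ∈ C) ∧ Asymptotic c β := by
  choose c hc using fun n => hX.exists_geodesic x (f n)
  have hlen : Tendsto (fun n => dist x (f n)) atTop atTop := by
    refine tendsto_atTop_mono (f := fun n : ℕ => (n : ℝ) + (-(dist x (β 0) + K))) (fun n => ?_)
      (tendsto_natCast_atTop_atTop.atTop_add tendsto_const_nhds)
    have h₁ := dist_triangle4 (β 0) x (f n) (β n)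
    rw [β.dist_zero_apply, dist_comm (β 0) x, NNReal.coe_natCast] at h₁
    linarith [hK n]
  have hev : ∀ t : ℝ≥0, ∀ᶠ n in (hyperfilter ℕ : Filter ℕ),
      (t : ℝ) ≤ dist x (f n) ∧ t < (n : ℝ≥0) := fun t =>
    ((hlen.eventually_ge_atTop _).and
      (tendsto_natCast_atTop_atTop.eventually_gt_atTop t)).filter_mono Nat.hyperfilter_le_atTop
  obtain ⟨b, hb0, hb⟩ := exists_limit_ray hc hlen
  refine ⟨b, hb0, fun t => ?_, dist x (β 0) + 2 * K, fun t => ?_⟩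
  · refine hC.mem_of_tendsto (hb t) ?_
    filter_upwards [hev t] with n hn
    exact hconv x hx _ (hf n) _ (hc n) _ ⟨t.coe_nonneg, hn.1⟩
  · refine le_of_tendsto ((hb t).dist tendsto_const_nhds) ?_
    filter_upwards [hev t] with n hn
    have hn0 : (0 : ℝ≥0) < n := (zero_le : 0 ≤ t).trans_lt hn.2
    refine (hX.dist_ray_le (hc n) β hn0 hn.2.le hn.1).trans ?_
    have h₁ : (t : ℝ) / (n : ℝ≥0) ≤ 1 := (div_le_one (by exact_mod_cast hn0)).2 (by
      exact_mod_cast hn.2.le)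
    have h₂ : (t : ℝ) / (n : ℝ≥0) * dist (f n) (β n) ≤ 1 * K :=
      mul_le_mul h₁ (hK n) dist_nonneg zero_le_one
    linarith

theorem IsCAT0.exists_asymptotic_ray [ProperSpace X] (hX : IsCAT0 X) (x : X)
    (β : GeodesicRay X) : ∃ c : GeodesicRay X, c 0 = x ∧ Asymptotic c β := by
  obtain ⟨c, h0, -, h⟩ := hX.exists_asymptotic_ray_mem isClosed_univ
    (fun _ _ _ _ _ _ _ _ => mem_univ _) β (f := fun n => β n) (K := 0) (fun _ => mem_univ _)
    (fun n => (dist_self _).le) (mem_univ x)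
  exact ⟨c, h0, h⟩

theorem IsCAT0.exists_ray_endpoint_eq [ProperSpace X] (hX : IsCAT0 X) (x : X)
    (η : Boundary X) : ∃ c : GeodesicRay X, c 0 = x ∧ c.endpoint = η := by
  obtain ⟨β, rfl⟩ := Quotient.exists_rep η
  obtain ⟨c, h0, h⟩ := hX.exists_asymptotic_ray x β
  exact ⟨c, h0, endpoint_eq_iff.2 h⟩

/-! ### The distance to a closed convex set along a ray -/

/-- The geodesic between points of F nearest to the two ends stays in F; its distance to the ray is
bounded by the convex combination. -/
theorem IsCAT0.infDist_ray_convex [ProperSpace X] (hX : IsCAT0 X) {F : Set X}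
    (hF : IsClosed F) (hconv : IsGeodesicallyConvex F) (hne : F.Nonempty) (β : GeodesicRay X)
    {a b c : ℝ≥0} (hab : a ≤ b) (hbc : b < c) :
    ((c : ℝ) - a) * Metric.infDist (β b) F ≤
      (c - b) * Metric.infDist (β a) F + (b - a) * Metric.infDist (β c) F := by
  have hab' : (a : ℝ) ≤ b := hab
  have hbc' : (b : ℝ) < c := hbc
  have hac : (0 : ℝ) < c - a := by linarith
  obtain ⟨y, hy, hya⟩ := hF.exists_infDist_eq_dist hne (β a)
  obtain ⟨z, hz, hzc⟩ := hF.exists_infDist_eq_dist hne (β c)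
  obtain ⟨h, hh⟩ := hX.exists_geodesic y z
  have hs : ((b - a) / (c - a) : ℝ) ∈ Icc (0 : ℝ) 1 :=
    ⟨div_nonneg (by linarith) hac.le, (div_le_one hac).2 (by linarith)⟩
  have key := hX.dist_le_convex_comb (β.isGeodesic (hab.trans hbc.le)) hh hs
  rw [β.dist_apply_of_le (hab.trans hbc.le), div_mul_cancel₀ _ hac.ne', ← NNReal.coe_sub hab,
    Real.toNNReal_coe, add_tsub_cancel_of_le hab, ← hya, ← hzc, NNReal.coe_sub hab] at key
  have hmem : h ((b - a) / (c - a) * dist y z) ∈ F := hconv y hy z hz h hh _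
    ⟨mul_nonneg hs.1 dist_nonneg, mul_le_of_le_one_left dist_nonneg hs.2⟩
  have := mul_le_mul_of_nonneg_left ((Metric.infDist_le_dist_of_mem hmem).trans key) hac.le
  refine this.trans_eq ?_
  field_simp
  ring

/-- A convex function that has increased once keeps growing with at least the slope δ of that
increase. -/
theorem IsCAT0.tendsto_infDist_ray [ProperSpace X] (hX : IsCAT0 X) {F : Set X}
    (hF : IsClosed F) (hconv : IsGeodesicallyConvex F) (hne : F.Nonempty) (β : GeodesicRay X)
    {s t : ℝ≥0} (hst : s ≤ t) (h : Metric.infDist (β s) F < Metric.infDist (β t) F) :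
    Tendsto (fun v => Metric.infDist (β v) F) atTop atTop := by
  have hst' : (s : ℝ) < t := by
    rcases hst.eq_or_lt with rfl | h'
    · exact absurd h (lt_irrefl _)
    · exact h'
  set δ := (Metric.infDist (β t) F - Metric.infDist (β s) F) / (t - s) with hδ
  have hδ0 : 0 < δ := div_pos (sub_pos.2 h) (sub_pos.2 hst')
  refine tendsto_atTop_mono' atTop (f₁ := fun v : ℝ≥0 => ((v : ℝ) + (-t)) * δ) ?_
    ((NNReal.tendsto_coe_atTop.2 tendsto_id).atTop_add tendsto_const_nhds |>.atTop_mul_const hδ0)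
  filter_upwards [eventually_gt_atTop t] with v hv
  have := hX.infDist_ray_convex hF hconv hne β hst hv
  have hv' : (t : ℝ) < v := hv
  have e : δ * (t - s) = Metric.infDist (β t) F - Metric.infDist (β s) F :=
    div_mul_cancel₀ _ (sub_pos.2 hst').ne'
  have h0 : 0 ≤ Metric.infDist (β t) F := Metric.infDist_nonneg
  refine le_of_mul_le_mul_left ?_ (sub_pos.2 hst')
  nlinarith

theorem IsCAT0.infDist_ray_le_of_le [ProperSpace X] (hX : IsCAT0 X) {F : Set X}
    (hF : IsClosed F) (hconv : IsGeodesicallyConvex F) (hne : F.Nonempty) (β : GeodesicRay X)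
    {s t v : ℝ≥0} (hst : s ≤ t) (htv : t ≤ v)
    (h : Metric.infDist (β s) F < Metric.infDist (β t) F) :
    Metric.infDist (β t) F ≤ Metric.infDist (β v) F := by
  rcases htv.eq_or_lt with rfl | htv
  · exact le_rfl
  have := hX.infDist_ray_convex hF hconv hne β hst htv
  have hv' : (t : ℝ) < v := htv
  have hst' : (s : ℝ) < t := by
    rcases hst.eq_or_lt with rfl | h'
    · exact absurd h (lt_irrefl _)
    · exact h'
  refine le_of_mul_le_mul_left ?_ (sub_pos.2 hst')
  nlinarith

theorem IsCAT0.endpoint_mem_boundaryOf [ProperSpace X] (hX : IsCAT0 X) {F : Set X}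
    (hF : IsClosed F) (hconv : IsGeodesicallyConvex F) (hne : F.Nonempty) (β : GeodesicRay X)
    {K : ℝ} (h : ∀ n : ℕ, Metric.infDist (β n) F ≤ K) : β.endpoint ∈ boundaryOf F := by
  choose f hf hd using fun n : ℕ => hF.exists_infDist_eq_dist hne (β n)
  obtain ⟨x, hx⟩ := hne
  obtain ⟨c, -, hc, ha⟩ := hX.exists_asymptotic_ray_mem hF hconv β hf
    (fun n => by rw [dist_comm, ← hd]; exact h n) hx
  exact ⟨c, hc, endpoint_eq_iff.2 ha⟩

theorem endpoint_notMem_boundaryOf {F : Set X} {β : GeodesicRay X}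
    (h : Tendsto (fun v => Metric.infDist (β v) F) atTop atTop) :
    β.endpoint ∉ boundaryOf F := by
  rintro ⟨c, hc, he⟩
  obtain ⟨K, hK⟩ := endpoint_eq_iff.1 he
  obtain ⟨v, hv⟩ := (h.eventually_gt_atTop K).exists
  have := Metric.infDist_le_dist_of_mem (x := β v) (hc v)
  rw [dist_comm] at this
  linarith [hK v]

/-! ### Convergence in the cone topology -/

/-- Serves both for the orbit of a base point under a hyperbolic isometry and for the marked points
of the rays given by almost extendibility. -/
theorem IsCAT0.tendsto_dist_geodesic_ray (hX : IsCAT0 X) (β : GeodesicRay X) {y : ℕ → X}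
    {c : ℕ → ℝ → X} (hc : ∀ i, IsGeodesic (c i) (β 0) (y i)) {T : ℕ → ℝ≥0}
    (hT : Tendsto T atTop atTop) {K : ℝ} (hK : ∀ i, dist (y i) (β (T i)) ≤ K) (R : ℝ≥0) :
    (∀ᶠ i in atTop, (R : ℝ) < dist (β 0) (y i)) ∧
      Tendsto (fun i => dist (c i R) (β R)) atTop (𝓝 0) := by
  have hT' : Tendsto (fun i => (T i : ℝ)) atTop atTop := NNReal.tendsto_coe_atTop.2 hT
  have hev : ∀ᶠ i in atTop, (R : ℝ) < dist (β 0) (y i) := by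
    filter_upwards [hT'.eventually_gt_atTop (R + K)] with i hi
    have := dist_triangle (β 0) (y i) (β (T i))
    rw [β.dist_zero_apply] at this
    linarith [hK i]
  refine ⟨hev, ?_⟩
  have hlim : Tendsto (fun i => 2 * ((R : ℝ) / T i) * K) atTop (𝓝 0) := by
    simpa using ((tendsto_const_nhds (x := (R : ℝ))).div_atTop hT' |>.const_mul 2).mul_const K
  refine squeeze_zero' (Eventually.of_forall fun _ => dist_nonneg) ?_ hlim
  filter_upwards [hev, hT.eventually_gt_atTop R] with i hi hRT
  have := hX.dist_ray_le (hc i) β ((zero_le : 0 ≤ R).trans_lt hRT) hRT.le hi.le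
  rw [dist_self, zero_add] at this
  exact this.trans (mul_le_mul_of_nonneg_left (hK i) (by positivity))

/-- A subbasic set containing the end point of β may be centred at another ray α; the slack ε,
uniform in α, takes care of this. -/
theorem IsCAT0.tendsto_coneTopology (hX : IsCAT0 X) {β : GeodesicRay X} {x₀ : X}
    (h0 : β 0 = x₀) {u : ℕ → X ⊕ Boundary X}
    (hu : ∀ (R : ℝ≥0) (ε : ℝ), 0 < ε → ∀ᶠ i in atTop, ∀ α : GeodesicRay X,
      ∀ δ, dist (α R) (β R) + ε ≤ δ → u i ∈ coneNhd x₀ α R δ) :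
    Tendsto u atTop (@nhds _ (coneTopology x₀) (Sum.inr β.endpoint)) := by
  let _ := coneTopology x₀
  rw [TopologicalSpace.tendsto_nhds_generateFrom_iff]
  rintro W (⟨V, -, rfl⟩ | ⟨α, R, ε, -, -, -, rfl⟩) hW
  · simp at hW
  · have hd : dist (α R) (β R) < ε := by
      rcases hW with ⟨_, _, h⟩ | ⟨ξ, ⟨β', h0', he, hd⟩, h⟩
      · cases h
      · cases h
        rwa [hX.ray_eq_of_endpoint_eq (h0.trans h0'.symm) he.symm]
    filter_upwards [hu R (ε - dist (α R) (β R)) (by linarith)] with i hi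
    exact hi α ε (by linarith)

theorem IsCAT0.tendsto_endpoint (hX : IsCAT0 X) {β : GeodesicRay X} {x₀ : X} (h0 : β 0 = x₀)
    {ζ : ℕ → GeodesicRay X} (hζ : ∀ i, ζ i 0 = x₀)
    (h : ∀ R, Tendsto (fun i => dist (ζ i R) (β R)) atTop (𝓝 0)) :
    Tendsto (fun i => (ζ i).endpoint) atTop
      (@nhds _ (boundaryTopology x₀) β.endpoint) := by
  let _ := coneTopology x₀
  rw [nhds_induced, tendsto_comap_iff]
  refine hX.tendsto_coneTopology h0 fun R ε hε => ?_
  filter_upwards [(h R).eventually_lt_const hε] with i hi α δ hδ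
  refine Or.inr ⟨_, ⟨ζ i, hζ i, rfl, ?_⟩, rfl⟩
  linarith [dist_triangle (α R) (β R) (ζ i R), dist_comm (ζ i R) (β R)]

theorem isOpen_of_forall_ray {x₀ : X} {S : Set (Boundary X)}
    (h : ∀ ξ ∈ S, ∃ β : GeodesicRay X, β 0 = x₀ ∧ β.endpoint = ξ ∧ ∃ R > 0, ∃ ε > 0,
      ∀ β' : GeodesicRay X, β' 0 = x₀ → dist (β R) (β' R) < ε → β'.endpoint ∈ S) :
    IsOpen[boundaryTopology x₀] S := by
  refine (@isOpen_iff_forall_mem_open _ (boundaryTopology x₀) S).2 fun ξ hξ => ?_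
  obtain ⟨β, h0, rfl, R, hR, ε, hε, hS⟩ := h ξ hξ
  refine ⟨Sum.inr ⁻¹' coneNhd x₀ β R ε, ?_,
    ⟨_, TopologicalSpace.isOpen_generateFrom_of_mem
      (Or.inr ⟨β, R, ε, h0, hR, hε, rfl⟩), rfl⟩, ?_⟩
  · rintro η (⟨_, _, h⟩ | ⟨ξ, ⟨β', h0', rfl, hd⟩, h⟩)
    · cases h
    · cases h
      exact hS β' h0' hd
  · exact Or.inr ⟨_, ⟨β, h0, rfl, by rwa [dist_self]⟩, rfl⟩

/-! ### Axes of hyperbolic isometries -/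

theorem translationLength_le (g : X ≃ᵢ X) (x : X) : translationLength g ≤ dist x (g x) :=
  ciInf_le ⟨0, by rintro _ ⟨y, rfl⟩; exact dist_nonneg⟩ x

/-- If m is the midpoint of x and gx, then gm is that of gx and g²x; comparison at the apex gx gives
d(m, gm) ≤ d(x, g²x) / 2. -/
theorem IsCAT0.two_mul_translationLength_le (hX : IsCAT0 X) (g : X ≃ᵢ X) (x : X) :
    2 * translationLength g ≤ dist x (g (g x)) := by
  obtain ⟨c, hc⟩ := hX.exists_geodesic x (g x)
  have h := hX.dist_le_mul hc.symm (hc.comp_isometry g.isometry) (s := 1 / 2) (by norm_num)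
  rw [dist_comm (g x) x, g.isometry.dist_eq,
    show dist x (g x) - 1 / 2 * dist x (g x) = 1 / 2 * dist x (g x) by ring] at h
  linarith [translationLength_le g (c (1 / 2 * dist x (g x)))]

theorem IsCAT0.translationLength_mul_self (hX : IsCAT0 X) {g : X ≃ᵢ X} {p : X}
    (hp : p ∈ minSet g) :
    translationLength (g * g) = 2 * translationLength g ∧ p ∈ minSet (g * g) := by
  have hp' : dist p (g p) = translationLength g := hp
  have h₁ : 2 * translationLength g ≤ translationLength (g * g) := by
    have : Nonempty X := ⟨p⟩
    exact le_ciInf fun x => hX.two_mul_translationLength_le g x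
  have h₂ : dist p ((g * g) p) ≤ 2 * translationLength g := by
    have := dist_triangle p (g p) (g (g p))
    rw [g.isometry.dist_eq, hp'] at this
    rw [IsometryEquiv.mul_apply]
    linarith
  have h₃ := translationLength_le (g * g) p
  exact ⟨by linarith, show dist p ((g * g) p) = _ by linarith⟩

/-- Doubling settles the exponents 2^k. A general n follows because the path p, g^n p, g^(2^n) p
leaves no room for a shorter first leg. -/
theorem IsCAT0.dist_pow_apply (hX : IsCAT0 X) {g : X ≃ᵢ X} {p : X} (hp : p ∈ minSet g) (n : ℕ) :
    dist p ((g ^ n) p) = n * translationLength g := by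
  have hdouble : ∀ k : ℕ, translationLength (g ^ 2 ^ k) = 2 ^ k * translationLength g ∧
      p ∈ minSet (g ^ 2 ^ k) := by
    intro k
    induction k with
    | zero => simpa using hp
    | succ k ih =>
      have := hX.translationLength_mul_self ih.2
      rw [← pow_add, ← two_mul, ← pow_succ'] at this
      refine ⟨?_, this.2⟩
      rw [this.1, ih.1]
      ring
  have hle : ∀ m : ℕ, dist p ((g ^ m) p) ≤ m * translationLength g := by
    intro m
    induction m with
    | zero => simp
    | succ m ih =>
      have := dist_triangle p ((g ^ m) p) ((g ^ (m + 1)) p)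
      rw [pow_succ, IsometryEquiv.mul_apply, (g ^ m).isometry.dist_eq,
        show dist p (g p) = _ from hp] at this
      rw [pow_succ, IsometryEquiv.mul_apply]
      push_cast
      linarith
  refine le_antisymm (hle n) ?_
  have hn : n ≤ 2 ^ n := Nat.lt_two_pow_self.le
  have h₁ : dist p ((g ^ 2 ^ n) p) = 2 ^ n * translationLength g :=
    (hdouble n).2.trans (hdouble n).1
  have h₂ := dist_triangle p ((g ^ n) p) ((g ^ 2 ^ n) p)
  have h₃ : dist ((g ^ n) p) ((g ^ 2 ^ n) p) = dist p ((g ^ (2 ^ n - n)) p) := by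
    rw [← Nat.add_sub_cancel' hn, pow_add, IsometryEquiv.mul_apply, (g ^ n).isometry.dist_eq,
      Nat.add_sub_cancel' hn]
  have h₄ := hle (2 ^ n - n)
  rw [Nat.cast_sub hn] at h₄
  push_cast at h₄
  linarith

/-- Orbit distances add up, so g^k p lies on each geodesic from p to g^n p with n ≥ k, hence on a
limit ray of these geodesics. -/
theorem IsCAT0.exists_axis [ProperSpace X] (hX : IsCAT0 X) {g : X ≃ᵢ X} {p : X}
    (hp : p ∈ minSet g) (hg : 0 < translationLength g) :
    ∃ b : GeodesicRay X, b 0 = p ∧ ∀ k : ℕ, b (k * (translationLength g).toNNReal) = (g ^ k) p := by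
  choose c hc using fun n : ℕ => hX.exists_geodesic p ((g ^ n) p)
  obtain ⟨b, hb0, hb⟩ := exists_limit_ray hc (by
    simp only [hX.dist_pow_apply hp]
    exact tendsto_natCast_atTop_atTop.atTop_mul_const hg)
  refine ⟨b, hb0, fun k => tendsto_nhds_unique (hb _) (tendsto_const_nhds.congr' ?_)⟩
  filter_upwards [(eventually_ge_atTop k).filter_mono Nat.hyperfilter_le_atTop] with n hn
  have h := hX.geodesic_apply_dist (hc n) (y := (g ^ k) p) (by
    have h₃ : dist ((g ^ k) p) ((g ^ n) p) = dist p ((g ^ (n - k)) p) := by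
      rw [← Nat.add_sub_cancel' hn, pow_add, IsometryEquiv.mul_apply, (g ^ k).isometry.dist_eq,
        Nat.add_sub_cancel' hn]
    rw [h₃, hX.dist_pow_apply hp, hX.dist_pow_apply hp, hX.dist_pow_apply hp, Nat.cast_sub hn]
    ring)
  rw [hX.dist_pow_apply hp] at h
  rw [← h, NNReal.coe_mul, NNReal.coe_natCast, Real.coe_toNNReal _ hg.le]

theorem tendsto_natCast_mul_atTop {L : ℝ≥0} (hL : 0 < L) :
    Tendsto (fun k : ℕ => (k : ℝ≥0) * L) atTop atTop :=
  tendsto_natCast_atTop_atTop.atTop_mul_const hL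

theorem IsCAT0.isLimitAtInfinity [ProperSpace X] (hX : IsCAT0 X) {g : X ≃ᵢ X} {p : X}
    {b : GeodesicRay X} {L : ℝ≥0} (hL : 0 < L) (hb : ∀ k : ℕ, b (k * L) = (g ^ k) p) :
    IsLimitAtInfinity g b.endpoint := by
  intro x₀
  obtain ⟨β, h0, K, hK⟩ := hX.exists_asymptotic_ray x₀ b
  rw [← endpoint_eq_iff.2 ⟨K, hK⟩]
  choose c hc using fun n : ℕ => hX.exists_geodesic x₀ ((g ^ n) x₀)
  have key := hX.tendsto_dist_geodesic_ray β (y := fun i => (g ^ i) x₀) (c := c)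
    (by rwa [h0]) (tendsto_natCast_mul_atTop hL) (K := dist x₀ p + K) (fun i => by
      have := dist_triangle ((g ^ i) x₀) ((g ^ i) p) (β (i * L))
      rw [(g ^ i).isometry.dist_eq, ← hb, dist_comm (b _)] at this
      linarith [hK (i * L)])
  rw [h0] at key
  refine hX.tendsto_coneTopology h0 fun R ε hε => ?_
  filter_upwards [(key R).1, (key R).2.eventually_lt_const hε] with i h₁ h₂ α δ hδ
  refine Or.inl ⟨_, ⟨h₁, c i, hc i, ?_⟩, rfl⟩
  linarith [dist_triangle (α R) (β R) (c i R), dist_comm (c i R) (β R)]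

theorem apply_mem_minSet {g : X ≃ᵢ X} {p : X} (hp : p ∈ minSet g) : g p ∈ minSet g :=
  (g.isometry.dist_eq p (g p)).trans hp

theorem inv_apply_mem_minSet {g : X ≃ᵢ X} {p : X} (hp : p ∈ minSet g) : g⁻¹ p ∈ minSet g := by
  have h := (g⁻¹).isometry.dist_eq p (g p)
  have e₁ : g⁻¹ (g p) = p := g.symm_apply_apply p
  have e₂ : g (g⁻¹ p) = p := g.apply_symm_apply p
  rw [e₁] at h
  change dist (g⁻¹ p) (g (g⁻¹ p)) = _
  rw [e₂, h]
  exact hp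

/-- The path from c t through g p to g (c t) has length exactly d(p, gp). -/
theorem IsGeodesic.mem_minSet {g : X ≃ᵢ X} {p : X} (hp : p ∈ minSet g) {c : ℝ → X}
    (hc : IsGeodesic c p (g p)) {t : ℝ} (ht : t ∈ Icc 0 (dist p (g p))) : c t ∈ minSet g := by
  refine le_antisymm ?_ (translationLength_le g _)
  have h₁ := dist_triangle (c t) (g p) (g (c t))
  rw [g.isometry.dist_eq, hc.dist_left ht, hc.dist_right ht] at h₁
  have : dist p (g p) = translationLength g := hp
  linarith

/-! ### Walls -/

/-- A closed convex set `F` whose complement is separated by the open sets `P` and `N`. -/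
structure IsWall (F P N : Set X) : Prop where
  isClosed : IsClosed F
  convex : IsGeodesicallyConvex F
  nonempty : F.Nonempty
  isOpen_left : IsOpen P
  isOpen_right : IsOpen N
  disjoint : Disjoint P N
  union_eq : P ∪ N = Fᶜ

namespace IsWall

variable {F P N : Set X}

theorem symm (h : IsWall F P N) : IsWall F N P :=
  ⟨h.isClosed, h.convex, h.nonempty, h.isOpen_right, h.isOpen_left, h.disjoint.symm,
    (union_comm _ _).trans h.union_eq⟩

theorem image (h : IsWall F P N) (g : X ≃ᵢ X) : IsWall (g '' F) (g '' P) (g '' N) where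
  isClosed := g.toHomeomorph.isClosedMap _ h.isClosed
  convex := by
    rintro _ ⟨x, hx, rfl⟩ _ ⟨y, hy, rfl⟩ c hc t ht
    have hc' := hc.comp_isometry g.symm.isometry
    rw [g.symm_apply_apply, g.symm_apply_apply] at hc'
    rw [g.isometry.dist_eq] at ht
    exact ⟨_, h.convex x hx y hy _ hc' t ht, g.apply_symm_apply _⟩
  nonempty := h.nonempty.image g
  isOpen_left := g.toHomeomorph.isOpenMap _ h.isOpen_left
  isOpen_right := g.toHomeomorph.isOpenMap _ h.isOpen_right
  disjoint := (disjoint_image_iff g.injective).2 h.disjoint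
  union_eq := by rw [← image_union, h.union_eq, image_compl_eq g.bijective]

theorem mem_of_geodesic (h : IsWall F P N) {x y : X} {c : ℝ → X} (hc : IsGeodesic c x y)
    (hF : ∀ t ∈ Icc (0 : ℝ) (dist x y), c t ∉ F) (hx : x ∈ P) : y ∈ P := by
  refine IsPreconnected.subset_left_of_subset_union h.isOpen_left h.isOpen_right h.disjoint ?_
    ⟨x, hc.left_mem_image, hx⟩ hc.isPreconnected_image hc.right_mem_image
  rw [h.union_eq]
  rintro _ ⟨t, ht, rfl⟩
  exact hF t ht

theorem mem_of_dist_lt (h : IsWall F P N) (hX : IsCAT0 X) {x y : X}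
    (hd : dist x y < Metric.infDist x F) (hx : x ∈ P) : y ∈ P := by
  obtain ⟨c, hc⟩ := hX.exists_geodesic x y
  refine h.mem_of_geodesic hc (fun t ht htF => ?_) hx
  have := Metric.infDist_le_dist_of_mem (x := x) htF
  rw [hc.dist_left ht] at this
  linarith [ht.2]

theorem ray_mem (h : IsWall F P N) {β : GeodesicRay X} {s t : ℝ≥0} (hst : s ≤ t)
    (hF : ∀ v, s ≤ v → β v ∉ F) (hs : β s ∈ P) : β t ∈ P :=
  h.mem_of_geodesic (β.isGeodesic hst) (fun _ _ => hF _ le_self_add) hs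

theorem notMem_of_infDist_pos {x : X} (hx : 0 < Metric.infDist x F) : x ∉ F := fun hxF => by
  rw [Metric.infDist_zero_of_mem hxF] at hx
  exact lt_irrefl _ hx

variable [ProperSpace X]

theorem ray_mem_of_infDist_lt (h : IsWall F P N) (hX : IsCAT0 X) {β : GeodesicRay X}
    {s t v : ℝ≥0} (hst : s ≤ t) (hd : Metric.infDist (β s) F < Metric.infDist (β t) F)
    (ht : β t ∈ P) (htv : t ≤ v) : β v ∈ P := by
  refine h.ray_mem htv (fun w hw => notMem_of_infDist_pos ?_) ht
  exact (Metric.infDist_nonneg.trans_lt hd).trans_le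
    (hX.infDist_ray_le_of_le h.isClosed h.convex h.nonempty β hst hw hd)

theorem tendsto_infDist (h : IsWall F P N) (hX : IsCAT0 X) {β : GeodesicRay X}
    (hβ : β.endpoint ∉ boundaryOf F) :
    Tendsto (fun v => Metric.infDist (β v) F) atTop atTop := by
  -- Otherwise the ray stays within its initial distance of F and is asymptotic to a ray in F.
  obtain ⟨R, hR⟩ : ∃ R, Metric.infDist (β 0) F < Metric.infDist (β R) F := by
    by_contra! hcon
    exact hβ (hX.endpoint_mem_boundaryOf h.isClosed h.convex h.nonempty β fun n => hcon n)
  exact hX.tendsto_infDist_ray h.isClosed h.convex h.nonempty β zero_le hR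

end IsWall

/-- The end points of the rays from `x₀` that move away from `F` inside `N`. -/
def farSide (x₀ : X) (F N : Set X) : Set (Boundary X) :=
  {ξ | ∃ β : GeodesicRay X, β 0 = x₀ ∧ β.endpoint = ξ ∧
    ∃ R, Metric.infDist x₀ F < Metric.infDist (β R) F ∧ β R ∈ N}

theorem isOpen_farSide (x₀ : X) (F : Set X) {N : Set X} (hN : IsOpen N) :
    IsOpen[boundaryTopology x₀] (farSide x₀ F N) := by
  refine isOpen_of_forall_ray ?_
  rintro ξ ⟨β, h0, he, R, hR, hRN⟩
  have hopen : IsOpen ({y | Metric.infDist x₀ F < Metric.infDist y F} ∩ N) :=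
    (isOpen_lt continuous_const (Metric.continuous_infDist_pt F)).inter hN
  obtain ⟨ε, hε, hball⟩ := Metric.isOpen_iff.1 hopen (β R) ⟨hR, hRN⟩
  refine ⟨β, h0, he, R, pos_iff_ne_zero.2 ?_, ε, hε, fun β' h0' hd => ?_⟩
  · rintro rfl
    rw [h0] at hR
    exact lt_irrefl _ hR
  · have := hball (Metric.mem_ball'.2 hd)
    exact ⟨β', h0', rfl, R, this.1, this.2⟩

namespace IsWall

variable {F P N : Set X} [ProperSpace X]

theorem of_mem_farSide (h : IsWall F P N) (hX : IsCAT0 X) {x₀ : X} {β : GeodesicRay X}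
    (h0 : β 0 = x₀) (hβ : β.endpoint ∈ farSide x₀ F P) :
    Tendsto (fun v => Metric.infDist (β v) F) atTop atTop ∧ ∀ᶠ v in atTop, β v ∈ P := by
  obtain ⟨β', h0', he, R, hR, hRP⟩ := hβ
  obtain rfl := hX.ray_eq_of_endpoint_eq (h0'.trans h0.symm) he
  rw [← h0] at hR
  refine ⟨hX.tendsto_infDist_ray h.isClosed h.convex h.nonempty _ zero_le hR, ?_⟩
  filter_upwards [eventually_ge_atTop R] with v hv
  exact h.ray_mem_of_infDist_lt hX zero_le hR hRP hv

theorem disjoint_farSide (h : IsWall F P N) (hX : IsCAT0 X) (x₀ : X) :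
    Disjoint (farSide x₀ F P) (farSide x₀ F N) := by
  refine Set.disjoint_left.2 fun ξ hP hN => ?_
  obtain ⟨β, h0, rfl⟩ := hX.exists_ray_endpoint_eq x₀ ξ
  obtain ⟨v, hv⟩ := ((h.of_mem_farSide hX h0 hP).2.and (h.symm.of_mem_farSide hX h0 hN).2).exists
  exact Set.disjoint_left.1 h.disjoint hv.1 hv.2

theorem farSide_union_farSide (h : IsWall F P N) (hX : IsCAT0 X) (x₀ : X) :
    farSide x₀ F P ∪ farSide x₀ F N = (boundaryOf F)ᶜ := by
  ext ξ
  obtain ⟨β, h0, rfl⟩ := hX.exists_ray_endpoint_eq x₀ ξ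
  constructor
  · rintro (hξ | hξ)
    · exact endpoint_notMem_boundaryOf (h.of_mem_farSide hX h0 hξ).1
    · exact endpoint_notMem_boundaryOf (h.symm.of_mem_farSide hX h0 hξ).1
  · intro hξ
    obtain ⟨R, hR⟩ :=
      ((h.tendsto_infDist hX hξ).eventually_gt_atTop (Metric.infDist x₀ F)).exists
    have hRF : β R ∈ P ∪ N := by
      rw [h.union_eq]
      exact notMem_of_infDist_pos (Metric.infDist_nonneg.trans_lt hR)
    exact hRF.imp (fun hP => ⟨β, h0, rfl, R, hR, hP⟩) (fun hN => ⟨β, h0, rfl, R, hR, hN⟩)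

theorem isOpen_compl_boundaryOf (h : IsWall F P N) (hX : IsCAT0 X) (x₀ : X) :
    IsOpen[boundaryTopology x₀] (boundaryOf F)ᶜ := by
  rw [← h.farSide_union_farSide hX x₀]
  exact @IsOpen.union _ _ _ (boundaryTopology x₀) (isOpen_farSide x₀ F h.isOpen_left)
    (isOpen_farSide x₀ F h.isOpen_right)

theorem endpoint_mem_farSide (h : IsWall F P N) (hX : IsCAT0 X) (x₀ : X) {b : GeodesicRay X}
    (hb : b.endpoint ∉ boundaryOf F) (hbP : ∃ᶠ v in atTop, b v ∈ P) :
    b.endpoint ∈ farSide x₀ F P := by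
  obtain ⟨β, h0, he⟩ := hX.exists_ray_endpoint_eq x₀ b.endpoint
  obtain ⟨K, hK⟩ := endpoint_eq_iff.1 he
  have h₁ := h.tendsto_infDist hX hb
  have h₂ := h.tendsto_infDist hX (β := β) (by rwa [he])
  obtain ⟨v, hvP, hv₁, hv₂⟩ := (hbP.and_eventually ((h₁.eventually_gt_atTop K).and
    (h₂.eventually_gt_atTop (Metric.infDist x₀ F)))).exists
  refine ⟨β, h0, he, v, hv₂, h.mem_of_dist_lt hX (x := b v) ?_ hvP⟩
  rw [dist_comm]
  exact (hK v).trans_lt hv₁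

end IsWall

/-! ### Reflections -/

theorem IsCAT0.isGeodesicallyConvex_fixedSet (hX : IsCAT0 X) (r : X ≃ᵢ X) :
    IsGeodesicallyConvex (fixedSet r) := by
  intro x hx y hy c hc t ht
  have h := hc.comp_isometry r.isometry
  rw [show r x = x from hx, show r y = y from hy] at h
  exact hX.geodesic_unique h hc ht

theorem IsCAT0.isOpen_connectedComponentIn (hX : IsCAT0 X) {U : Set X} (hU : IsOpen U) (x : X) :
    IsOpen (connectedComponentIn U x) := by
  refine Metric.isOpen_iff.2 fun y hy => ?_
  obtain ⟨ε, hε, hball⟩ := Metric.isOpen_iff.1 hU y (connectedComponentIn_subset _ _ hy)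
  refine ⟨ε, hε, fun z hz => ?_⟩
  obtain ⟨c, hc⟩ := hX.exists_geodesic y z
  rw [connectedComponentIn_eq hy]
  refine hc.isPreconnected_image.subset_connectedComponentIn hc.left_mem_image ?_
    hc.right_mem_image
  rintro _ ⟨t, ht, rfl⟩
  refine hball (Metric.mem_ball'.2 ?_)
  rw [hc.dist_left ht]
  exact ht.2.trans_lt (Metric.mem_ball'.1 hz)

/-- An involution reverses the geodesic from x to rx, so it fixes its midpoint. -/
theorem IsCAT0.fixedSet_nonempty (hX : IsCAT0 X) {r : X ≃ᵢ X} (hr : ∀ x, r (r x) = x) (x : X) :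
    (fixedSet r).Nonempty := by
  obtain ⟨c, hc⟩ := hX.exists_geodesic x (r x)
  have h := (hc.comp_isometry r.isometry).symm
  rw [hr, dist_comm (r x) x] at h
  have hmid := hX.geodesic_unique h hc (t := dist x (r x) / 2)
    ⟨by positivity, by linarith [@dist_nonneg _ _ x (r x)]⟩
  rw [sub_half] at hmid
  exact ⟨_, hmid⟩

theorem IsReflection.exists_isWall (hX : IsCAT0 X) {r : X ≃ᵢ X} (hr : IsReflection r) {p : X}
    (hp : p ∉ fixedSet r) :
    ∃ P N, IsWall (fixedSet r) P N ∧ r '' P = N ∧ p ∈ P := by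
  obtain ⟨hrr, P, N, hPN, hcomp, -, -, hrP⟩ := hr
  have hclosed : IsClosed (fixedSet r) := isClosed_eq r.continuous continuous_id
  obtain ⟨a, ha, hPa⟩ : P ∈ componentsOf (fixedSet r)ᶜ := by simp [hcomp]
  obtain ⟨b, hb, hNb⟩ : N ∈ componentsOf (fixedSet r)ᶜ := by simp [hcomp]
  have hwall : IsWall (fixedSet r) P N := by
    refine ⟨hclosed, hX.isGeodesicallyConvex_fixedSet r, hX.fixedSet_nonempty hrr p, ?_, ?_, ?_, ?_⟩
    · rw [hPa]
      exact hX.isOpen_connectedComponentIn hclosed.isOpen_compl a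
    · rw [hNb]
      exact hX.isOpen_connectedComponentIn hclosed.isOpen_compl b
    · refine Set.disjoint_left.2 fun z hzP hzN => hPN ?_
      rw [hPa] at hzP ⊢
      rw [hNb] at hzN ⊢
      rw [connectedComponentIn_eq hzP, connectedComponentIn_eq hzN]
    · refine Subset.antisymm (union_subset ?_ ?_) fun x hx => ?_
      · rw [hPa]
        exact connectedComponentIn_subset _ _
      · rw [hNb]
        exact connectedComponentIn_subset _ _
      · have hx' : connectedComponentIn (fixedSet r)ᶜ x ∈ ({P, N} : Set (Set X)) :=
          hcomp ▸ ⟨x, hx, rfl⟩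
        have hmem := mem_connectedComponentIn hx
        rcases hx' with h | h
        · exact Or.inl (h ▸ hmem)
        · exact Or.inr (h ▸ hmem)
  have hp' : p ∈ P ∪ N := by
    rw [hwall.union_eq]
    exact hp
  rcases hp' with hp' | hp'
  · exact ⟨P, N, hwall, hrP, hp'⟩
  · refine ⟨N, P, hwall.symm, ?_, hp'⟩
    rw [← hrP, image_image]
    simp [hrr]

theorem infDist_apply_fixedSet (r : X ≃ᵢ X) (x : X) :
    Metric.infDist (r x) (fixedSet r) = Metric.infDist x (fixedSet r) := by
  have : r '' fixedSet r = fixedSet r :=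
    (image_congr fun x (hx : r x = x) => hx).trans (image_id' _)
  conv_lhs => rw [← this]
  exact Metric.infDist_image r.isometry

/-! ### Orbits in Min(γ) and translates of the wall -/

theorem IsWall.minSet_side (hX : IsCAT0 X) {F P N : Set X} (h : IsWall F P N) {g : X ≃ᵢ X}
    (hF : minSet g ∩ F = ∅) {q : X} (hq : q ∈ minSet g) : q ∈ P ↔ g q ∈ P := by
  obtain ⟨c, hc⟩ := hX.exists_geodesic q (g q)
  have hcF : ∀ t ∈ Icc (0 : ℝ) (dist q (g q)), c t ∉ F := fun t ht htF => by
    have : c t ∈ minSet g ∩ F := ⟨hc.mem_minSet hq ht, htF⟩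
    simp [hF] at this
  refine ⟨h.mem_of_geodesic hc hcF, h.mem_of_geodesic hc.symm fun t ht => hcF _ ?_⟩
  rw [dist_comm] at ht
  exact ⟨by linarith [ht.2], by linarith [ht.1]⟩

/-- This places q in every translate g^i P. -/
theorem IsWall.inv_pow_apply_mem (hX : IsCAT0 X) {F P N : Set X} (h : IsWall F P N) {g : X ≃ᵢ X}
    (hF : minSet g ∩ F = ∅) (i : ℕ) {q : X} (hq : q ∈ minSet g) (hqP : q ∈ P) :
    (g ^ i)⁻¹ q ∈ P := by
  rw [← inv_pow]
  induction i generalizing q with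
  | zero => simpa
  | succ i ih =>
    rw [pow_succ, IsometryEquiv.mul_apply]
    refine ih (inv_apply_mem_minSet hq) ?_
    rw [h.minSet_side hX hF (inv_apply_mem_minSet hq)]
    rwa [show g (g⁻¹ q) = q from g.apply_symm_apply q]

theorem IsWall.pow_apply_mem (hX : IsCAT0 X) {F P N : Set X} (h : IsWall F P N) {g : X ≃ᵢ X}
    (hF : minSet g ∩ F = ∅) (i : ℕ) {q : X} (hq : q ∈ minSet g) (hqP : q ∈ P) :
    (g ^ i) q ∈ minSet g ∩ P := by
  induction i generalizing q with
  | zero => exact ⟨by simpa, by simpa⟩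
  | succ i ih =>
    rw [pow_succ, IsometryEquiv.mul_apply]
    exact ih (apply_mem_minSet hq) ((h.minSet_side hX hF hq).1 hqP)

/-- A ray in g^i F is the image under g^i of a ray in F, and g maps the boundary of F into itself.
-/
theorem boundaryOf_image_pow_subset {g : X ≃ᵢ X} {F : Set X}
    (h : boundaryMap g '' boundaryOf F ⊆ boundaryOf F) (i : ℕ) :
    boundaryOf ((g ^ i) '' F) ⊆ boundaryOf F := by
  have hmap : ∀ c : GeodesicRay X, c.endpoint ∈ boundaryOf F →
      (c.map (g ^ i)).endpoint ∈ boundaryOf F := by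
    induction i with
    | zero => exact fun c hc => hc
    | succ i ih =>
      intro c hc
      rw [pow_succ]
      exact ih (c.map g) (h ⟨_, hc, rfl⟩)
  rintro _ ⟨c, hc, rfl⟩
  have hcF : (c.map (g ^ i)⁻¹).endpoint ∈ boundaryOf F := by
    refine ⟨_, fun t => ?_, rfl⟩
    obtain ⟨x, hx, hxc⟩ := hc t
    have : (g ^ i)⁻¹ (c t) = x := by
      rw [← hxc]
      exact (g ^ i).symm_apply_apply x
    exact (congrArg (· ∈ F) this).mpr hx
  convert hmap _ hcF
  obtain ⟨c, hc'⟩ := c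
  simp only [GeodesicRay.map, GeodesicRay.mk.injEq]
  exact funext fun t => ((g ^ i).apply_symm_apply _).symm

/-- A ray from `x₀` passing near a point deep in `N` ends in the far side of `N`. -/
theorem IsWall.endpoint_mem_farSide_of_deep [ProperSpace X] (hX : IsCAT0 X) {F P N : Set X}
    (h : IsWall F P N) {x₀ p y : X} {M : ℝ} (hp : p ∈ P) (hy : y ∈ N)
    (hd : M + dist x₀ p < Metric.infDist y F) {ζ : GeodesicRay X} (h0 : ζ 0 = x₀) {t : ℝ≥0}
    (ht : dist (ζ t) y ≤ M) : ζ.endpoint ∈ farSide x₀ F N := by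
  have htN : ζ t ∈ N := by
    refine h.symm.mem_of_dist_lt hX ?_ hy
    rw [dist_comm]
    linarith [@dist_nonneg _ _ x₀ p]
  have htd : dist x₀ p < Metric.infDist (ζ t) F := by
    have := Metric.infDist_le_infDist_add_dist (s := F) (x := y) (y := ζ t)
    rw [dist_comm y] at this
    linarith
  -- The base point may lie on either side. If the ray kept farther than d(x₀, p) from F up to time
  -- t, then x₀ would be in N, and so would p.
  obtain ⟨s, hst, hs⟩ : ∃ s ≤ t, Metric.infDist (ζ s) F ≤ dist x₀ p := by
    by_contra! hcon
    have hx₀ : x₀ ∈ N := by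
      have := h.symm.mem_of_geodesic (ζ.isGeodesic (zero_le : 0 ≤ t)).symm (fun v hv => ?_) htN
      · rwa [h0] at this
      refine notMem_of_infDist_pos (dist_nonneg.trans_lt (hcon _ ?_))
      rw [zero_add, Real.toNNReal_le_iff_le_coe, ζ.dist_zero_apply]
      linarith [hv.1]
    have hpN := h.symm.mem_of_dist_lt hX (y := p) (by simpa [h0] using hcon 0 zero_le) hx₀
    exact Set.disjoint_left.1 h.disjoint hp hpN
  have hlt := hs.trans_lt htd
  obtain ⟨R, hR, htR⟩ := (((hX.tendsto_infDist_ray h.isClosed h.convex h.nonempty ζ hst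
    hlt).eventually_gt_atTop (Metric.infDist x₀ F)).and (eventually_ge_atTop t)).exists
  exact ⟨ζ, h0, rfl, R, hR, h.symm.ray_mem_of_infDist_lt hX hst hlt htN htR⟩

end CATZero

/-! ### Failure of local connectedness at γ^∞ -/

theorem theorem1 {X : Type u} [MetricSpace X] [ProperSpace X] (hX : IsCAT0 X)
    (hext : IsAlmostExtendible X)
    (γ : X ≃ᵢ X) (hγ : IsHyperbolic γ)
    (r : X ≃ᵢ X) (hr : IsReflection r)
    (h1 : ∀ η : Boundary X, IsLimitAtInfinity γ η → η ∉ boundaryOf (fixedSet r))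
    (h2 : boundaryMap γ '' boundaryOf (fixedSet r) ⊆ boundaryOf (fixedSet r))
    (h3 : minSet γ ∩ fixedSet r = ∅)
    (x₀ : X) :
    ¬ @LocallyConnectedSpace (Boundary X) (boundaryTopology x₀) := by
  intro hloc
  let _ := boundaryTopology x₀
  obtain ⟨⟨p, hp⟩, hpos⟩ := hγ
  obtain ⟨M, -, hM⟩ := hext
  have hL : 0 < (translationLength γ).toNNReal := Real.toNNReal_pos.2 hpos
  obtain ⟨b, -, hb⟩ := hX.exists_axis hp hpos
  have hη := h1 _ (hX.isLimitAtInfinity hL hb)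
  obtain ⟨P, N, hwall, hrP, hpP⟩ := hr.exists_isWall hX (p := p) fun hpF => by
    have : p ∈ minSet γ ∩ fixedSet r := ⟨hp, hpF⟩
    simp [h3] at this
  -- This depth is preserved by r and by each γ^i, and p lies in every γ^i P, so one n serves for
  -- all i.
  obtain ⟨n, hn⟩ := (((hwall.tendsto_infDist hX hη).comp
    (tendsto_natCast_mul_atTop hL)).eventually_gt_atTop (M + dist x₀ p)).exists
  have hyN : r ((γ ^ n) p) ∈ N :=
    hrP ▸ mem_image_of_mem r (hwall.pow_apply_mem hX h3 n hp hpP).2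
  have hyd : M + dist x₀ p < Metric.infDist (r ((γ ^ n) p)) (fixedSet r) := by
    rw [infDist_apply_fixedSet, ← hb]
    exact hn
  have himage : ∀ (i : ℕ) (q : X), q ∈ minSet γ → q ∈ P → q ∈ (γ ^ i) '' P := fun i q hq hqP =>
    ⟨_, hwall.inv_pow_apply_mem hX h3 i hq hqP, (γ ^ i).apply_symm_apply q⟩
  choose ζ hζ0 t ht using fun i : ℕ => hM x₀ ((γ ^ i) (r ((γ ^ n) p)))
  have hfar : ∀ i : ℕ, (ζ i).endpoint ∈ farSide x₀ ((γ ^ i) '' fixedSet r) ((γ ^ i) '' N) := fun i =>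
    (hwall.image (γ ^ i)).endpoint_mem_farSide_of_deep hX (himage i p hp hpP)
      (mem_image_of_mem _ hyN) (by rwa [Metric.infDist_image (γ ^ i).isometry]) (hζ0 i) (ht i)
  have hnear : ∀ i : ℕ, b.endpoint ∈ farSide x₀ ((γ ^ i) '' fixedSet r) ((γ ^ i) '' P) := fun i =>
    (hwall.image (γ ^ i)).endpoint_mem_farSide hX x₀
      (fun h => hη (boundaryOf_image_pow_subset h2 i h))
      ((tendsto_natCast_mul_atTop hL).frequently (Eventually.of_forall fun k => by
        have := hwall.pow_apply_mem hX h3 k hp hpP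
        rw [hb]
        exact himage i _ this.1 this.2).frequently)
  obtain ⟨β, h0, he⟩ := hX.exists_ray_endpoint_eq x₀ b.endpoint
  obtain ⟨K, hK⟩ := endpoint_eq_iff.1 he
  have hlim : Tendsto (fun i => (ζ i).endpoint) atTop (𝓝 b.endpoint) := by
    rw [← he]
    refine hX.tendsto_endpoint h0 hζ0 fun R => ?_
    -- The point of ζ_i near γ^i y is at bounded distance from γ^i p, hence from the ray β at the
    -- time when b reaches γ^i p.
    have := (hX.tendsto_dist_geodesic_ray β (y := fun i => ζ i (t i))
      (c := fun i s => ζ i (0 + s.toNNReal))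
      (fun i => by
        have := (ζ i).isGeodesic (zero_le : 0 ≤ t i)
        rwa [hζ0 i, ← h0] at this) (tendsto_natCast_mul_atTop hL)
      (K := M + dist (r ((γ ^ n) p)) p + K) (fun i => ?_) R).2
    · simpa using this
    · have h₁ := dist_triangle4 (ζ i (t i)) ((γ ^ i) (r ((γ ^ n) p))) ((γ ^ i) p)
        (β (i * (translationLength γ).toNNReal))
      rw [(γ ^ i).isometry.dist_eq, ← hb i, dist_comm (b _)] at h₁
      linarith [ht i, hK (i * (translationLength γ).toNNReal)]
  have hU := hwall.isOpen_compl_boundaryOf hX x₀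
  -- Local connectedness makes the component of γ^∞ in the complement of ∂F open, so it contains
  -- some ζ_i(∞).
  obtain ⟨i, hi⟩ := (hlim.eventually (hU.connectedComponentIn.mem_nhds
    (mem_connectedComponentIn hη))).exists
  have hwi := hwall.image (γ ^ i)
  -- This component avoids ∂(γ^i F), so it lies wholly on the side of γ^i F containing γ^∞.
  have hsub := IsPreconnected.subset_left_of_subset_union
    (isOpen_farSide x₀ ((γ ^ i) '' fixedSet r) hwi.isOpen_left)
    (isOpen_farSide x₀ ((γ ^ i) '' fixedSet r) hwi.isOpen_right) (hwi.disjoint_farSide hX x₀)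
    (s := connectedComponentIn (boundaryOf (fixedSet r))ᶜ b.endpoint)
    (by
      rw [hwi.farSide_union_farSide hX x₀]
      exact (connectedComponentIn_subset _ _).trans
        (compl_subset_compl.2 (boundaryOf_image_pow_subset h2 i)))
    ⟨_, mem_connectedComponentIn hη, hnear i⟩ isPreconnected_connectedComponentIn
  exact Set.disjoint_left.1 (hwi.disjoint_farSide hX x₀) (hsub hi) (hfar i)
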